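/- A map $M$ on a surface is recorded by its flags (incident triples of a vertex, an edge and a face); for $i\in\{0,1,2\}$ let $r_i$ be the involution of the set of flags that sends each flag to the unique flag differing from it precisely in the vertex ($i=0$), the edge ($i=1$), or the face ($i=2$). The monodromy group of $M$ is $\mathrm{Mon}(M)=\langle r_0,r_1,r_2\rangle$, a subgroup of the group of permutations of the flags. The minimal regular cover $\widetilde M$ of $M$ is the regular map with automorphism group $\mathrm{Mon}(M)$: its flags are the elements of $\mathrm{Mon}(M)$, and the $i$-adjacent flag of $g$ is $g r_i$; hence its faces are the cosets $g\langle r_0,r_1\rangle$ and its edges are the cosets $g\langle r_0,r_2\rangle$, two such cosets being incident when they intersect. The dual graph of a map has the faces of the map as its vertices, two different faces being adjacent if and only if they share an edge. **Lemma.** Let $\Lambda$ be the dual graph of the minimal regular cover of the Archimedean tiling 3.6.3.6 of the Euclidean plane by equilateral triangles and regular hexagons, and let $$H=\langle a,b,c \mid a^2=b^2=c^2=(abc)^2=1\rangle .$$ Then the edges of $\Lambda$ can be labelled in such a way that $\Lambda$ is the Cayley graph of a group $G\cong H\times H$. More precisely, there are a group $G$ with an isomorphism $e\colon G\to H\times H$,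 the finite generating set $A\subset G$ with $$e(A)=\{(a,1),(b,1),(c,1),(1,a),(1,b),(1,c)\},$$ which is closed under inverses and does not contain $1$, a labelling of the (undirected) edges of $\Lambda$ by elements of $G$, and a bijection $\varphi$ from $G$ to the vertex set of $\Lambda$, such that $\varphi$ is a graph isomorphism from the Cayley graph of $G$ with respect to $A$ to $\Lambda$, and for all $g\in G$ and $x\in A$ the edge of $\Lambda$ joining $\varphi(g)$ and $\varphi(gx)$ has the label $x$. -/

import Mathlib

/-! ## Maps on surfaces, given by their flags -/

/-- A map on a surface, recorded by its flags: `adj i Φ` is the `i`-adjacent flag of `Φ`, i.e. the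
flag that differs from `Φ` precisely in its vertex (`i = 0`), its edge (`i = 1`), its face
(`i = 2`). The surface is obtained by taking one triangle for every flag and gluing, for every
`i`, the sides labelled `i` of the triangles `Φ` and `adj i Φ`. -/
structure FlagMap where
  /-- the flags -/
  Flag : Type
  /-- `i`-adjacency of flags -/
  adj : Fin 3 → Equiv.Perm Flag
  nonempty : Nonempty Flag
  adj_adj : ∀ i Φ, adj i (adj i Φ) = Φ
  adj_ne : ∀ i Φ, adj i Φ ≠ Φ
  adj_ne_adj : ∀ i j Φ, i ≠ j → adj i Φ ≠ adj j Φ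
  adj_comm : ∀ Φ, adj 0 (adj 2 Φ) = adj 2 (adj 0 Φ)

namespace FlagMap

/-- The monodromy group: the group of permutations of the flags generated by the three
adjacencies. -/
def Mon (M : FlagMap) : Subgroup (Equiv.Perm M.Flag) :=
  Subgroup.closure (Set.range M.adj)

/-- The generators `r₀`, `r₁`, `r₂` of the monodromy group. -/
def monGen (M : FlagMap) (i : Fin 3) : M.Mon :=
  ⟨M.adj i, Subgroup.subset_closure ⟨i, rfl⟩⟩

theorem monGen_mul_self (M : FlagMap) (i : Fin 3) : M.monGen i * M.monGen i = 1 :=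
  Subtype.ext (Equiv.ext fun Φ => M.adj_adj i Φ)

theorem monGen_ne_one (M : FlagMap) (i : Fin 3) : M.monGen i ≠ 1 := by
  intro h
  obtain ⟨Φ⟩ := M.nonempty
  exact M.adj_ne i Φ (Equiv.congr_fun (congrArg Subtype.val h) Φ)

theorem monGen_ne (M : FlagMap) {i j : Fin 3} (hij : i ≠ j) : M.monGen i ≠ M.monGen j := by
  intro h
  obtain ⟨Φ⟩ := M.nonempty
  exact M.adj_ne_adj i j Φ hij (Equiv.congr_fun (congrArg Subtype.val h) Φ)

theorem monGen_comm (M : FlagMap) : M.monGen 0 * M.monGen 2 = M.monGen 2 * M.monGen 0 :=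
  Subtype.ext (Equiv.ext fun Φ => M.adj_comm Φ)

/-- The minimal regular cover of `M`: the regular map whose automorphism group is the monodromy
group of `M`. It has one flag for every element of the monodromy group, the `i`-adjacent flag of
`g` is `g * rᵢ`, and the group acts on the flags by left multiplication. -/
def minimalRegularCover (M : FlagMap) : FlagMap where
  Flag := M.Mon
  adj i := Equiv.mulRight (M.monGen i)
  nonempty := ⟨1⟩
  adj_adj i g := by
    simp only [Equiv.coe_mulRight, mul_assoc, monGen_mul_self, mul_one]
  adj_ne i g := by
    simpa only [Equiv.coe_mulRight, ne_eq, mul_eq_left] using M.monGen_ne_one i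
  adj_ne_adj i j g hij := by
    simpa only [Equiv.coe_mulRight, ne_eq, mul_right_inj] using M.monGen_ne hij
  adj_comm g := by
    simp only [Equiv.coe_mulRight, mul_assoc, monGen_comm]

/-- The cells of dimension `i` of a map (vertices for `i = 0`, edges for `i = 1`, faces for
`i = 2`). The flags containing a given cell form an orbit of the group generated by the two
adjacencies that do not change the `i`-th entry of a flag. -/
def Cell (M : FlagMap) (i : Fin 3) : Type :=
  MulAction.orbitRel.Quotient
    (Subgroup.closure (M.adj '' {j | j ≠ i}) : Subgroup (Equiv.Perm M.Flag)) M.Flag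

/-- The cell of dimension `i` of a flag. -/
def cell (M : FlagMap) (i : Fin 3) (Φ : M.Flag) : M.Cell i :=
  Quotient.mk _ Φ

/-- Two cells of a map are incident if some flag contains both of them. -/
def Incident (M : FlagMap) {i j : Fin 3} (c : M.Cell i) (d : M.Cell j) : Prop :=
  ∃ Φ : M.Flag, M.cell i Φ = c ∧ M.cell j Φ = d

/-- The dual graph of a map: its vertices are the faces of the map, and two different faces are
adjacent if and only if they share an edge. -/
def dualGraph (M : FlagMap) : SimpleGraph (M.Cell 2) where
  Adj F F' := F ≠ F' ∧ ∃ e : M.Cell 1, M.Incident e F ∧ M.Incident e F'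
  symm := ⟨fun _ _ h => ⟨h.1.symm, h.2.imp fun _ he => ⟨he.2, he.1⟩⟩⟩
  loopless := ⟨fun _ h => h.1 rfl⟩

end FlagMap

/-! ## The Archimedean tiling 3.6.3.6 -/

namespace Trihexagonal

/-- The points of the triangular lattice: `(x, y)` stands for `x + y ζ` with `ζ = exp (π i / 3)`. -/
abbrev Pt : Type := ℤ × ℤ

/-- The position of a lattice point in the Euclidean plane. -/
noncomputable def pos (p : Pt) : ℂ :=
  p.1 + p.2 * Complex.exp ((Real.pi / 3 : ℝ) * Complex.I)

/-- The squared Euclidean distance of two lattice points. -/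
def sqDist (p q : Pt) : ℤ :=
  (q.1 - p.1) ^ 2 + (q.1 - p.1) * (q.2 - p.2) + (q.2 - p.2) ^ 2

theorem dist_pos_sq (p q : Pt) : dist (pos p) (pos q) ^ 2 = sqDist p q := by
  rw [dist_comm, Complex.dist_eq, ← Complex.normSq_eq_norm_sq, Complex.normSq_apply]
  have h3 : Real.sqrt 3 ^ 2 = 3 := Real.sq_sqrt (by norm_num)
  simp only [pos, sqDist, Complex.sub_re, Complex.sub_im, Complex.add_re, Complex.add_im,
    Complex.mul_re, Complex.mul_im, Complex.exp_ofReal_mul_I_re, Complex.exp_ofReal_mul_I_im,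
    Real.cos_pi_div_three, Real.sin_pi_div_three, Complex.intCast_re, Complex.intCast_im]
  push_cast
  linear_combination (((q.2 : ℝ) - p.2) ^ 2 / 4) * h3

/-- The vertices of the tiling: all lattice points except those of the sublattice of index 4 formed
by the centres of the hexagons. -/
def IsVertex (p : Pt) : Prop := ¬ (Even p.1 ∧ Even p.2)

instance : DecidablePred IsVertex := fun p => inferInstanceAs (Decidable (¬ (Even p.1 ∧ Even p.2)))

/-- The edges of the tiling, given by their end points: pairs of vertices at distance 1. -/
def IsEdge (e : Finset Pt) : Prop :=
  ∃ v w, IsVertex v ∧ IsVertex w ∧ sqDist v w = 1 ∧ e = {v, w}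

/-- The regular hexagon with centre `c` and sides of length 1, given by its corners. -/
def hexagon (c : Pt) : Finset Pt :=
  {c + (1, 0), c + (0, 1), c + (-1, 1), c + (-1, 0), c + (0, -1), c + (1, -1)}

/-- The faces of the tiling, given by their corners: the regular hexagons of side 1 around the
lattice points that are not vertices, and the equilateral triangles of side 1 spanned by
vertices. -/
def IsFace (F : Finset Pt) : Prop :=
  (∃ c, ¬ IsVertex c ∧ F = hexagon c) ∨
  (∃ u v w, IsVertex u ∧ IsVertex v ∧ IsVertex w ∧
    sqDist u v = 1 ∧ sqDist v w = 1 ∧ sqDist u w = 1 ∧ F = {u, v, w})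

/-- A flag of the tiling: an incident triple of a vertex, an edge and a face. -/
@[ext]
structure Flag where
  vertex : Pt
  edge : Finset Pt
  face : Finset Pt
  isEdge : IsEdge edge
  isFace : IsFace face
  vertex_mem : vertex ∈ edge
  edge_subset : edge ⊆ face

/-- The flag `Ψ` is `i`-adjacent to `Φ` if it differs from `Φ` precisely in the vertex (`i = 0`),
the edge (`i = 1`) or the face (`i = 2`). -/
def IsAdj (i : Fin 3) (Φ Ψ : Flag) : Prop :=
  (Ψ.vertex = Φ.vertex ↔ i ≠ 0) ∧ (Ψ.edge = Φ.edge ↔ i ≠ 1) ∧ (Ψ.face = Φ.face ↔ i ≠ 2)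

/-! Every flag has exactly one `i`-adjacent flag. This is checked at three vertices and transported
by translations. -/

/-- The six lattice vectors of length 1. -/
def steps : Finset Pt := {(1, 0), (0, 1), (-1, 1), (-1, 0), (0, -1), (1, -1)}

theorem sqDist_eq_one_iff (p q : Pt) : sqDist p q = 1 ↔ ∃ u ∈ steps, q = p + u := by
  obtain ⟨a, b⟩ := p
  obtain ⟨c, d⟩ := q
  constructor
  · intro h
    refine ⟨(c - a, d - b), ?_, by ext <;> simp⟩
    simp only [sqDist] at h
    generalize c - a = x at h
    generalize d - b = y at h
    have hx1 : x ≤ 1 := by nlinarith [sq_nonneg (x + 2 * y)]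
    have hx2 : -1 ≤ x := by nlinarith [sq_nonneg (x + 2 * y)]
    have hy1 : y ≤ 1 := by nlinarith [sq_nonneg (2 * x + y)]
    have hy2 : -1 ≤ y := by nlinarith [sq_nonneg (2 * x + y)]
    interval_cases x <;> interval_cases y <;> first | decide | (exfalso; revert h; decide)
  · rintro ⟨u, hu, h⟩
    simp only [steps, Finset.mem_insert, Finset.mem_singleton] at hu
    obtain ⟨rfl, rfl⟩ := Prod.mk.inj h
    rcases hu with rfl | rfl | rfl | rfl | rfl | rfl <;> simp [sqDist]

theorem sqDist_comm (p q : Pt) : sqDist p q = sqDist q p := by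
  simp only [sqDist]; ring

/-- The edges at `v`. -/
def edgesAt (v : Pt) : Finset (Finset Pt) :=
  (steps.filter fun u => IsVertex v ∧ IsVertex (v + u)).image fun u => {v, v + u}

/-- The faces at `v`. -/
def facesAt (v : Pt) : Finset (Finset Pt) :=
  (steps.filter fun u => ¬ IsVertex (v + u)).image (fun u => hexagon (v + u)) ∪
  ((steps ×ˢ steps).filter fun u => IsVertex v ∧ IsVertex (v + u.1) ∧ IsVertex (v + u.2) ∧
    sqDist u.1 u.2 = 1).image fun u => {v, v + u.1, v + u.2}

theorem mem_edgesAt {v : Pt} {e : Finset Pt} : e ∈ edgesAt v ↔ IsEdge e ∧ v ∈ e := by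
  simp only [edgesAt, Finset.mem_image, Finset.mem_filter]
  constructor
  · rintro ⟨u, ⟨hu, h1, h2⟩, rfl⟩
    exact ⟨⟨v, v + u, h1, h2, (sqDist_eq_one_iff _ _).2 ⟨u, hu, rfl⟩, rfl⟩, by simp⟩
  · rintro ⟨⟨a, b, ha, hb, hab, rfl⟩, hv⟩
    simp only [Finset.mem_insert, Finset.mem_singleton] at hv
    rcases hv with rfl | rfl
    · obtain ⟨u, hu, rfl⟩ := (sqDist_eq_one_iff _ _).1 hab
      exact ⟨u, ⟨hu, ha, hb⟩, rfl⟩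
    · rw [sqDist_comm] at hab
      obtain ⟨u, hu, rfl⟩ := (sqDist_eq_one_iff _ _).1 hab
      exact ⟨u, ⟨hu, hb, ha⟩, Finset.pair_comm _ _⟩

theorem mem_hexagon {c p : Pt} : p ∈ hexagon c ↔ sqDist c p = 1 := by
  rw [sqDist_eq_one_iff]
  simp [hexagon, steps]

theorem sqDist_add_left (v a b : Pt) : sqDist (v + a) (v + b) = sqDist a b := by
  simp only [sqDist, Prod.fst_add, Prod.snd_add]; ring

theorem triangle_mem_facesAt {u v w : Pt} (hu : IsVertex u) (hv : IsVertex v) (hw : IsVertex w)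
    (huv : sqDist u v = 1) (huw : sqDist u w = 1) (hvw : sqDist v w = 1) :
    ({u, v, w} : Finset Pt) ∈ facesAt u := by
  obtain ⟨a, ha, rfl⟩ := (sqDist_eq_one_iff _ _).1 huv
  obtain ⟨b, hb, rfl⟩ := (sqDist_eq_one_iff _ _).1 huw
  rw [sqDist_add_left] at hvw
  refine Finset.mem_union_right _ (Finset.mem_image.2 ⟨(a, b), ?_, rfl⟩)
  simp only [Finset.mem_filter, Finset.mem_product]
  exact ⟨⟨ha, hb⟩, hu, hv, hw, hvw⟩

theorem mem_facesAt {v : Pt} {F : Finset Pt} : F ∈ facesAt v ↔ IsFace F ∧ v ∈ F := by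
  constructor
  · intro h
    rcases Finset.mem_union.1 h with h | h
    · simp only [Finset.mem_image, Finset.mem_filter] at h
      obtain ⟨u, ⟨hu, hv⟩, rfl⟩ := h
      refine ⟨Or.inl ⟨_, hv, rfl⟩, ?_⟩
      rw [mem_hexagon, sqDist_comm, sqDist_eq_one_iff]
      exact ⟨u, hu, rfl⟩
    · simp only [Finset.mem_image, Finset.mem_filter, Finset.mem_product] at h
      obtain ⟨u, ⟨⟨hu1, hu2⟩, h0, h1, h2, h12⟩, rfl⟩ := h
      refine ⟨Or.inr ⟨v, v + u.1, v + u.2, h0, h1, h2, ?_, ?_, ?_, rfl⟩, by simp⟩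
      · exact (sqDist_eq_one_iff _ _).2 ⟨_, hu1, rfl⟩
      · rw [sqDist_add_left, h12]
      · exact (sqDist_eq_one_iff _ _).2 ⟨_, hu2, rfl⟩
  · rintro ⟨⟨c, hc, rfl⟩ | ⟨a, b, c, ha, hb, hc, hab, hbc, hac, rfl⟩, hv⟩
    · rw [mem_hexagon, sqDist_comm] at hv
      obtain ⟨u, hu, rfl⟩ := (sqDist_eq_one_iff _ _).1 hv
      refine Finset.mem_union_left _ (Finset.mem_image.2 ⟨u, ?_, rfl⟩)
      exact Finset.mem_filter.2 ⟨hu, hc⟩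
    · simp only [Finset.mem_insert, Finset.mem_singleton] at hv
      rcases hv with rfl | rfl | rfl
      · exact triangle_mem_facesAt ha hb hc hab hac hbc
      · rw [Finset.insert_comm]
        exact triangle_mem_facesAt hb ha hc (by rwa [sqDist_comm]) hbc hac
      · have : ({a, b, v} : Finset Pt) = {v, a, b} := by
          ext; simp only [Finset.mem_insert, Finset.mem_singleton]; tauto
        rw [this]
        exact triangle_mem_facesAt hc ha hb (by rwa [sqDist_comm]) (by rwa [sqDist_comm]) hab

/-- Translation by `t` of a finite set of lattice points. -/
def shift (t : Pt) (s : Finset Pt) : Finset Pt := s.map (addRightEmbedding t)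

theorem shift_injective (t : Pt) : Function.Injective (shift t) :=
  Finset.map_injective _

theorem isVertex_add {t : Pt} (ht : ¬ IsVertex t) (v : Pt) : IsVertex (v + t) ↔ IsVertex v := by
  simp only [IsVertex, not_not] at ht ⊢
  simp only [Prod.fst_add, Prod.snd_add, Int.even_add, ht.1, ht.2, iff_true]

theorem edgesAt_add {t : Pt} (ht : ¬ IsVertex t) (v : Pt) :
    edgesAt (v + t) = (edgesAt v).image (shift t) := by
  simp only [edgesAt, Finset.image_image, add_right_comm v t, isVertex_add ht]
  refine Finset.image_congr fun u _ => ?_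
  simp [shift]

theorem facesAt_add {t : Pt} (ht : ¬ IsVertex t) (v : Pt) :
    facesAt (v + t) = (facesAt v).image (shift t) := by
  simp only [facesAt, Finset.image_union, Finset.image_image, add_right_comm v t, isVertex_add ht]
  congr 1
  · refine Finset.image_congr fun u _ => ?_
    simp [shift, hexagon, add_right_comm _ _ t]
  · refine Finset.image_congr fun u _ => ?_
    simp [shift]

/-- At `v`, every edge lies in exactly two faces, and every face at `v` has exactly two edges at
`v`. -/
def Good (v : Pt) : Prop :=
  ∀ e ∈ edgesAt v, ∀ F ∈ facesAt v, e ⊆ F →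
    (∃! e', e' ∈ edgesAt v ∧ e' ⊆ F ∧ e' ≠ e) ∧ (∃! F', F' ∈ facesAt v ∧ e ⊆ F' ∧ F' ≠ F)

theorem good_add {t : Pt} (ht : ¬ IsVertex t) {v : Pt} (h : Good v) : Good (v + t) := by
  intro e he F hF heF
  rw [edgesAt_add ht] at he
  rw [facesAt_add ht] at hF
  obtain ⟨e, he₀, rfl⟩ := Finset.mem_image.1 he
  obtain ⟨F, hF₀, rfl⟩ := Finset.mem_image.1 hF
  have hsub : ∀ a b, shift t a ⊆ shift t b ↔ a ⊆ b := fun a b => Finset.map_subset_map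
  obtain ⟨⟨e', ⟨h1, h2, h3⟩, h4⟩, ⟨F', ⟨k1, k2, k3⟩, k4⟩⟩ := h e he₀ F hF₀ ((hsub _ _).1 heF)
  constructor
  · refine ⟨shift t e', ⟨?_, (hsub _ _).2 h2, fun h => h3 (shift_injective t h)⟩, ?_⟩
    · rw [edgesAt_add ht]; exact Finset.mem_image_of_mem _ h1
    · rintro y ⟨y1, y2, y3⟩
      rw [edgesAt_add ht] at y1
      obtain ⟨y, y0, rfl⟩ := Finset.mem_image.1 y1
      rw [h4 y ⟨y0, (hsub _ _).1 y2, fun h => y3 (h ▸ rfl)⟩]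
  · refine ⟨shift t F', ⟨?_, (hsub _ _).2 k2, fun h => k3 (shift_injective t h)⟩, ?_⟩
    · rw [facesAt_add ht]; exact Finset.mem_image_of_mem _ k1
    · rintro y ⟨y1, y2, y3⟩
      rw [facesAt_add ht] at y1
      obtain ⟨y, y0, rfl⟩ := Finset.mem_image.1 y1
      rw [k4 y ⟨y0, (hsub _ _).1 y2, fun h => y3 (h ▸ rfl)⟩]

/-- A decidable form of `Good`. -/
theorem good_of_card {v : Pt} (h : ∀ e ∈ edgesAt v, ∀ F ∈ facesAt v, e ⊆ F →
    ((edgesAt v).filter fun e' => e' ⊆ F ∧ e' ≠ e).card = 1 ∧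
    ((facesAt v).filter fun F' => e ⊆ F' ∧ F' ≠ F).card = 1) : Good v := by
  intro e he F hF heF
  obtain ⟨h1, h2⟩ := h e he F hF heF
  obtain ⟨a, ha⟩ := Finset.card_eq_one.1 h1
  obtain ⟨b, hb⟩ := Finset.card_eq_one.1 h2
  refine ⟨⟨a, ?_, ?_⟩, ⟨b, ?_, ?_⟩⟩
  · have : a ∈ ({a} : Finset (Finset Pt)) := Finset.mem_singleton_self a
    rw [← ha, Finset.mem_filter] at this
    exact this
  · intro y hy
    rw [← Finset.mem_singleton, ← ha, Finset.mem_filter]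
    exact hy
  · have : b ∈ ({b} : Finset (Finset Pt)) := Finset.mem_singleton_self b
    rw [← hb, Finset.mem_filter] at this
    exact this
  · intro y hy
    rw [← Finset.mem_singleton, ← hb, Finset.mem_filter]
    exact hy

set_option maxRecDepth 100000 in
theorem good_base : Good (1, 0) ∧ Good (0, 1) ∧ Good (1, 1) :=
  ⟨good_of_card (by decide +kernel), good_of_card (by decide +kernel),
    good_of_card (by decide +kernel)⟩

theorem good_of_isVertex {v : Pt} (hv : IsVertex v) : Good v := by
  obtain ⟨x, y⟩ := v
  simp only [IsVertex] at hv
  have key : ∀ v₀ : Pt, Good v₀ → Even (x - v₀.1) → Even (y - v₀.2) → Good (x, y) := by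
    intro v₀ h₀ hx hy
    have h : ¬ IsVertex (x - v₀.1, y - v₀.2) := by
      simp only [IsVertex, not_not]; exact ⟨hx, hy⟩
    have := good_add h h₀
    have hxy : v₀ + (x - v₀.1, y - v₀.2) = (x, y) := by ext <;> simp
    rwa [hxy] at this
  by_cases hx : Even x
  · have hy : ¬ Even y := fun hy => hv ⟨hx, hy⟩
    exact key (0, 1) good_base.2.1 (by simpa using hx) (by simpa [Int.even_sub_one] using hy)
  · by_cases hy : Even y
    · exact key (1, 0) good_base.1 (by simpa [Int.even_sub_one] using hx) (by simpa using hy)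
    · exact key (1, 1) good_base.2.2 (by simpa [Int.even_sub_one] using hx)
        (by simpa [Int.even_sub_one] using hy)

theorem existsUnique_isAdj (i : Fin 3) (Φ : Flag) : ∃! Ψ, IsAdj i Φ Ψ := by
  obtain ⟨v, e, F, he, hF, hv, heF⟩ := Φ
  have hvv : IsVertex v := by
    obtain ⟨a, b, ha, hb, -, rfl⟩ := he
    simp only [Finset.mem_insert, Finset.mem_singleton] at hv
    rcases hv with rfl | rfl <;> assumption
  have hgood := good_of_isVertex hvv e (mem_edgesAt.2 ⟨he, hv⟩) F (mem_facesAt.2 ⟨hF, heF hv⟩) heF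
  match i with
  | 0 =>
    have hw : ∃ w, w ∈ e ∧ w ≠ v ∧ ∀ x ∈ e, x ≠ v → x = w := by
      obtain ⟨a, b, ha, hb, hab, rfl⟩ := he
      have hne : a ≠ b := by rintro rfl; simp [sqDist] at hab
      simp only [Finset.mem_insert, Finset.mem_singleton] at hv
      rcases hv with rfl | rfl
      · exact ⟨b, by simp, hne.symm, by simp⟩
      · exact ⟨a, by simp, hne, by simp⟩
    obtain ⟨w, hw, hwv, huniq⟩ := hw
    refine ⟨⟨w, e, F, he, hF, hw, heF⟩, by simp [IsAdj, hwv], ?_⟩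
    rintro ⟨w', e', F', he', hF', hw', heF'⟩ h
    simp only [IsAdj] at h
    have h2 : e' = e := by simpa using h.2.1
    have h3 : F' = F := by simpa using h.2.2
    subst h2 h3
    have h1 := huniq w' hw' (by simpa using h.1)
    subst h1
    rfl
  | 1 =>
    obtain ⟨d, ⟨h1, h2, h3⟩, huniq⟩ := hgood.1
    have h1' := mem_edgesAt.1 h1
    refine ⟨⟨v, d, F, h1'.1, hF, h1'.2, h2⟩, by simp [IsAdj, h3], ?_⟩
    rintro ⟨v', e', F', he', hF', hv', heF'⟩ h
    simp only [IsAdj] at h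
    have h1 : v' = v := by simpa using h.1
    have h3 : F' = F := by simpa using h.2.2
    subst h1 h3
    have h2 := huniq e' ⟨mem_edgesAt.2 ⟨he', hv'⟩, heF', by simpa using h.2.1⟩
    subst h2
    rfl
  | 2 =>
    obtain ⟨K, ⟨h1, h2, h3⟩, huniq⟩ := hgood.2
    have h1' := mem_facesAt.1 h1
    refine ⟨⟨v, e, K, he, h1'.1, hv, h2⟩, by simp [IsAdj, h3], ?_⟩
    rintro ⟨v', e', F', he', hF', hv', heF'⟩ h
    simp only [IsAdj] at h
    have h1 : v' = v := by simpa using h.1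
    have h2 : e' = e := by simpa using h.2.1
    subst h1 h2
    have h3 := huniq F' ⟨mem_facesAt.2 ⟨hF', heF' hv'⟩, heF', by simpa using h.2.2⟩
    subst h3
    rfl

theorem IsAdj.symm {i : Fin 3} {Φ Ψ : Flag} (h : IsAdj i Φ Ψ) : IsAdj i Ψ Φ :=
  ⟨eq_comm.trans h.1, eq_comm.trans h.2.1, eq_comm.trans h.2.2⟩

/-- The `i`-adjacent flag. -/
noncomputable def adjFlag (i : Fin 3) (Φ : Flag) : Flag := (existsUnique_isAdj i Φ).choose

theorem isAdj_adjFlag (i : Fin 3) (Φ : Flag) : IsAdj i Φ (adjFlag i Φ) :=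
  (existsUnique_isAdj i Φ).choose_spec.1

theorem eq_adjFlag {i : Fin 3} {Φ Ψ : Flag} (h : IsAdj i Φ Ψ) : Ψ = adjFlag i Φ :=
  (existsUnique_isAdj i Φ).unique h (isAdj_adjFlag i Φ)

theorem adjFlag_adjFlag (i : Fin 3) (Φ : Flag) : adjFlag i (adjFlag i Φ) = Φ :=
  (eq_adjFlag (isAdj_adjFlag i Φ).symm).symm

theorem adjFlag_ne_adjFlag (i j : Fin 3) (Φ : Flag) (hij : i ≠ j) :
    adjFlag i Φ ≠ adjFlag j Φ := by
  intro h
  have hi := isAdj_adjFlag i Φ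
  have hj := isAdj_adjFlag j Φ
  rw [h] at hi
  simp only [IsAdj] at hi hj
  have h0 := hi.1.symm.trans hj.1
  have h1 := hi.2.1.symm.trans hj.2.1
  have h2 := hi.2.2.symm.trans hj.2.2
  clear hi hj h
  revert i j
  decide

theorem adjFlag_ne (i : Fin 3) (Φ : Flag) : adjFlag i Φ ≠ Φ := by
  intro h
  have hi := isAdj_adjFlag i Φ
  rw [h] at hi
  simp only [IsAdj, true_iff] at hi
  clear h
  revert i
  decide

theorem adjFlag_comm (Φ : Flag) : adjFlag 0 (adjFlag 2 Φ) = adjFlag 2 (adjFlag 0 Φ) := by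
  have hA := isAdj_adjFlag 2 Φ
  have hB := isAdj_adjFlag 0 Φ
  generalize adjFlag 2 Φ = A at hA ⊢
  generalize adjFlag 0 Φ = B at hB ⊢
  have a1 : A.vertex = Φ.vertex := by simpa using hA.1
  have a2 : A.edge = Φ.edge := by simpa using hA.2.1
  have a3 : A.face ≠ Φ.face := by simpa using hA.2.2
  have b1 : B.vertex ≠ Φ.vertex := by simpa using hB.1
  have b2 : B.edge = Φ.edge := by simpa using hB.2.1
  have b3 : B.face = Φ.face := by simpa using hB.2.2
  let X : Flag := ⟨B.vertex, Φ.edge, A.face, Φ.isEdge, A.isFace, b2 ▸ B.vertex_mem,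
    a2 ▸ A.edge_subset⟩
  have hX0 : IsAdj 0 A X := by simp [IsAdj, X, a1, a2, b1]
  have hX2 : IsAdj 2 B X := by simp [IsAdj, X, b2, b3, a3]
  rw [← eq_adjFlag hX0, ← eq_adjFlag hX2]

/-- The tiling 3.6.3.6 of the Euclidean plane, as a map. -/
noncomputable def tiling : FlagMap where
  Flag := Flag
  adj i := ⟨adjFlag i, adjFlag i, adjFlag_adjFlag i, adjFlag_adjFlag i⟩
  nonempty := by
    have he : IsEdge {(1, 0), (0, 1)} := ⟨_, _, by decide, by decide, by decide, rfl⟩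
    have hF : IsFace (hexagon (0, 0)) := Or.inl ⟨_, by decide, rfl⟩
    exact ⟨⟨(1, 0), {(1, 0), (0, 1)}, hexagon (0, 0), he, hF, by decide, by decide⟩⟩
  adj_adj := adjFlag_adjFlag
  adj_ne := adjFlag_ne
  adj_ne_adj := adjFlag_ne_adjFlag
  adj_comm := adjFlag_comm

end Trihexagonal

/-! ## The group `H` and labelled Cayley graphs -/

/-- The relators `a²`, `b²`, `c²`, `(abc)²`, where `a`, `b`, `c` are the generators `0`, `1`, `2`
of the free group. -/
def relatorsH : Set (FreeGroup (Fin 3)) :=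
  {FreeGroup.of 0 ^ 2, FreeGroup.of 1 ^ 2, FreeGroup.of 2 ^ 2,
    (FreeGroup.of 0 * FreeGroup.of 1 * FreeGroup.of 2) ^ 2}

/-- The group `H = ⟨a, b, c | a² = b² = c² = (abc)² = 1⟩`. -/
abbrev GroupH : Type := PresentedGroup relatorsH

/-- The generators `a`, `b`, `c` of `H`. -/
def genH (i : Fin 3) : GroupH := PresentedGroup.of i

/-- The edge labelling `label` makes the graph `Λ` the Cayley graph of the group `G` with respect
to `A`: here `A` is a finite generating set of `G` that is closed under inverses (and does not
contain `1`, so that the Cayley graph has no loops), and there is an isomorphism from the Cayley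
graph of `G` to `Λ` under which the edge joining `g` and `g * a` has the label `a`. -/
def IsCayleyLabelling {V G : Type} [Group G] (Λ : SimpleGraph V) (A : Set G)
    (label : Λ.edgeSet → G) : Prop :=
  A.Finite ∧ (∀ a ∈ A, a⁻¹ ∈ A) ∧ Subgroup.closure A = ⊤ ∧ (1 : G) ∉ A ∧
  ∃ φ : SimpleGraph.mulCayley A ≃g Λ, ∀ g : G, ∀ a ∈ A, ∀ h : Λ.Adj (φ g) (φ (g * a)),
    label ⟨s(φ g, φ (g * a)), h⟩ = a

/-! The symmetry group S of the tiling has two orbits of flags: those with a triangular face and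
those with a hexagonal one. Adjacency commutes with symmetries, so once `triFlag` and `hexFlag` are
fixed, the monodromy group acts on these orbits by right multiplications in S. Here r₀ is the same
reflection on both orbits, r₂ exchanges the orbits, and r₁ is one reflection on the triangular orbit
and another on the hexagonal one. The mirrors of these two meet at right angles in the base vertex.

Let D = ⟨r₀, r₁⟩. The involution r₂ has just six conjugates under D. All of them exchange the two
orbits. Three multiply by translations, opposite on the two orbits (`transGen`), and three by
half-turns, equal on the two orbits (`halfGen`). Each triple satisfies the relations of H, because
alternating sums of the vectors cancel. The two triples commute, because a half-turn inverts
translations and exchanging the orbits inverts them once more. This gives a homomorphism `prodHom`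
from H × H; let N be its image.

Since D normalises the set of conjugates, Mon = N D (`exists_eq_prodHom_mul`). Elements of D
preserve the face of every flag of the tiling, while by the normal form in H only the trivial
element of H × H acts in that way (`eq_one_of_face_eq`). This yields at once that `prodHom` is
injective and that N meets D trivially. Hence the faces mD of the cover correspond to the elements
of H × H. The neighbours of gD are the cosets g d r₂ D = g (d r₂ d⁻¹) D with d in D, that is, g is
multiplied by one of the six conjugates: this is the Cayley graph. -/

namespace Trihexagonal

/-! ## Symmetries of the tiling -/

/-- The symmetries of the tiling, as permutations of the lattice points. -/
def symGroup : Subgroup (Equiv.Perm Pt) where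
  carrier := {σ | ∀ p, (∀ q, sqDist (σ p) (σ q) = sqDist p q) ∧ (IsVertex (σ p) ↔ IsVertex p)}
  one_mem' p := ⟨fun _ => rfl, Iff.rfl⟩
  mul_mem' {σ τ} hσ hτ p :=
    ⟨fun q => ((hσ (τ p)).1 (τ q)).trans ((hτ p).1 q), (hσ (τ p)).2.trans (hτ p).2⟩
  inv_mem' {σ} hσ p := by
    have hinv : ∀ q, σ (σ⁻¹ q) = q := σ.apply_symm_apply
    exact ⟨fun q => by rw [← (hσ _).1, hinv, hinv], by rw [← (hσ _).2, hinv]⟩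

theorem symm_ext {σ τ : symGroup} (h : ∀ x y : ℤ, σ.1 (x, y) = τ.1 (x, y)) : σ = τ :=
  Subtype.ext (Equiv.ext fun p => h p.1 p.2)

/-- The image of a finite set of lattice points. -/
def image (σ : symGroup) (s : Finset Pt) : Finset Pt := s.map σ.1.toEmbedding

theorem image_injective (σ : symGroup) : Function.Injective (image σ) :=
  Finset.map_injective _

theorem image_mul (σ τ : symGroup) (s : Finset Pt) : image (σ * τ) s = image σ (image τ s) := by
  rw [image, image, image, Finset.map_map]
  rfl

theorem image_hexagon (σ : symGroup) (c : Pt) : image σ (hexagon c) = hexagon (σ.1 c) := by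
  ext p
  obtain ⟨q, rfl⟩ := σ.1.surjective p
  rw [mem_hexagon, (σ.2 c).1 q, ← mem_hexagon]
  exact Finset.mem_map' σ.1.toEmbedding

theorem IsEdge.image {e : Finset Pt} (he : IsEdge e) (σ : symGroup) : IsEdge (image σ e) := by
  obtain ⟨v, w, hv, hw, hvw, rfl⟩ := he
  exact ⟨σ.1 v, σ.1 w, (σ.2 v).2.2 hv, (σ.2 w).2.2 hw, ((σ.2 v).1 w).trans hvw,
    by simp [Trihexagonal.image]⟩

theorem IsFace.image {F : Finset Pt} (hF : IsFace F) (σ : symGroup) : IsFace (image σ F) := by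
  rcases hF with ⟨c, hc, rfl⟩ | ⟨u, v, w, hu, hv, hw, huv, hvw, huw, rfl⟩
  · exact Or.inl ⟨σ.1 c, fun h => hc ((σ.2 c).2.1 h), image_hexagon σ c⟩
  · exact Or.inr ⟨σ.1 u, σ.1 v, σ.1 w, (σ.2 u).2.2 hu, (σ.2 v).2.2 hv, (σ.2 w).2.2 hw,
      ((σ.2 u).1 v).trans huv, ((σ.2 v).1 w).trans hvw, ((σ.2 u).1 w).trans huw,
      by simp [Trihexagonal.image]⟩

/-- The action of the symmetries on the flags. -/
instance : SMul symGroup Flag where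
  smul σ Φ := ⟨σ.1 Φ.vertex, image σ Φ.edge, image σ Φ.face, Φ.isEdge.image σ, Φ.isFace.image σ,
    (Finset.mem_map' σ.1.toEmbedding).2 Φ.vertex_mem, Finset.map_subset_map.2 Φ.edge_subset⟩

theorem smul_face (σ : symGroup) (Φ : Flag) : (σ • Φ).face = image σ Φ.face := rfl

theorem mul_smul_flag (σ τ : symGroup) (Φ : Flag) : (σ * τ) • Φ = σ • τ • Φ :=
  Flag.ext rfl (image_mul σ τ Φ.edge) (image_mul σ τ Φ.face)

theorem one_smul_flag (Φ : Flag) : (1 : symGroup) • Φ = Φ :=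
  Flag.ext rfl (Finset.map_refl) (Finset.map_refl)

theorem IsAdj.smul {i : Fin 3} {Φ Ψ : Flag} (h : IsAdj i Φ Ψ) (σ : symGroup) :
    IsAdj i (σ • Φ) (σ • Ψ) :=
  ⟨σ.1.injective.eq_iff.trans h.1, (image_injective σ).eq_iff.trans h.2.1,
    (image_injective σ).eq_iff.trans h.2.2⟩

/-- Follows from uniqueness of the adjacent flag. This is what turns monodromy into right
multiplication on each orbit of symmetries. -/
theorem adjFlag_smul (i : Fin 3) (σ : symGroup) (Φ : Flag) :
    adjFlag i (σ • Φ) = σ • adjFlag i Φ :=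
  (eq_adjFlag ((isAdj_adjFlag i Φ).smul σ)).symm

/-- Rotation by `π / 3` around the origin. -/
def rho (u : Pt) : Pt := (-u.2, u.1 + u.2)

/-- Rotation by `-π / 3` around the origin. -/
def rhoInv (u : Pt) : Pt := (u.1 + u.2, -u.1)

theorem mem_steps {u : Pt} (hu : u ∈ steps) :
    u = (1, 0) ∨ u = (0, 1) ∨ u = (-1, 1) ∨ u = (-1, 0) ∨ u = (0, -1) ∨ u = (1, -1) := by
  simpa [steps] using hu

/-- The orientation preserving symmetry that sends `0` to `c` and `(1, 0)` to `c + u`. -/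
def rotation (c u : Pt) (hc : ¬ IsVertex c) (hu : u ∈ steps) : symGroup :=
  ⟨{ toFun p := (c.1 + p.1 * u.1 + p.2 * (rho u).1, c.2 + p.1 * u.2 + p.2 * (rho u).2)
     invFun p := ((u.1 + u.2) * (p.1 - c.1) + u.2 * (p.2 - c.2),
       -u.2 * (p.1 - c.1) + u.1 * (p.2 - c.2))
     left_inv p := by
      rcases mem_steps hu with rfl | rfl | rfl | rfl | rfl | rfl <;>
        ext <;> simp only [rho] <;> ring
     right_inv p := by
      rcases mem_steps hu with rfl | rfl | rfl | rfl | rfl | rfl <;>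
        ext <;> simp only [rho] <;> ring }, by
    intro p
    rcases mem_steps hu with rfl | rfl | rfl | rfl | rfl | rfl <;> constructor <;>
      simp only [sqDist, IsVertex, Equiv.coe_fn_mk, rho, Int.even_iff] at hc ⊢ <;>
      first | omega | exact fun q => by ring⟩

/-- The orientation reversing symmetry that sends `0` to `c` and `(1, 0)` to `c + u`. -/
def reflection (c u : Pt) (hc : ¬ IsVertex c) (hu : u ∈ steps) : symGroup :=
  ⟨{ toFun p := (c.1 + p.1 * u.1 + p.2 * (rhoInv u).1, c.2 + p.1 * u.2 + p.2 * (rhoInv u).2)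
     invFun p := (u.1 * (p.1 - c.1) + (u.1 + u.2) * (p.2 - c.2),
       u.2 * (p.1 - c.1) - u.1 * (p.2 - c.2))
     left_inv p := by
      rcases mem_steps hu with rfl | rfl | rfl | rfl | rfl | rfl <;>
        ext <;> simp only [rhoInv] <;> ring
     right_inv p := by
      rcases mem_steps hu with rfl | rfl | rfl | rfl | rfl | rfl <;>
        ext <;> simp only [rhoInv] <;> ring }, by
    intro p
    rcases mem_steps hu with rfl | rfl | rfl | rfl | rfl | rfl <;> constructor <;>
      simp only [sqDist, IsVertex, Equiv.coe_fn_mk, rhoInv, Int.even_iff] at hc ⊢ <;>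
      first | omega | exact fun q => by ring⟩

/-- Exactly one of the two lattice points that complete the edge to an equilateral triangle is the
centre of a hexagon, and that centre has to be the image of `0`. The side of the edge on which it
lies decides between a rotation and a reflection. -/
theorem exists_symm {v w : Pt} (hv : IsVertex v) (hw : IsVertex w) (h : sqDist v w = 1) :
    ∃ σ : symGroup, σ.1 (1, 0) = v ∧ σ.1 (0, 1) = w := by
  obtain ⟨u, hu, rfl⟩ := (sqDist_eq_one_iff _ _).1 h
  by_cases hc : IsVertex (v + rho u)
  · have hd : ¬ IsVertex (v + rhoInv u) := by
      rcases mem_steps hu with rfl | rfl | rfl | rfl | rfl | rfl <;>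
        simp only [IsVertex, rho, rhoInv, Int.even_iff, Prod.fst_add, Prod.snd_add] at * <;> omega
    have hs : -rhoInv u ∈ steps := by
      rcases mem_steps hu with rfl | rfl | rfl | rfl | rfl | rfl <;> decide
    refine ⟨reflection _ _ hd hs, ?_, ?_⟩ <;>
      ext <;> simp [reflection, rhoInv] <;> ring
  · have hs : -rho u ∈ steps := by
      rcases mem_steps hu with rfl | rfl | rfl | rfl | rfl | rfl <;> decide
    refine ⟨rotation _ _ hc hs, ?_, ?_⟩ <;>
      ext <;> simp [rotation, rho] <;> ring

/-- The flag with vertex `(1, 0)`, whose edge ends at `(0, 1)` and whose face is a triangle. -/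
def triFlag : Flag where
  vertex := (1, 0)
  edge := {(1, 0), (0, 1)}
  face := {(1, 0), (0, 1), (1, 1)}
  isEdge := ⟨_, _, by decide, by decide, by decide, rfl⟩
  isFace := Or.inr ⟨_, _, _, by decide, by decide, by decide, by decide, by decide, by decide, rfl⟩
  vertex_mem := by decide
  edge_subset := by decide

/-- The flag with vertex `(1, 0)`, whose edge ends at `(0, 1)` and whose face is a hexagon. -/
def hexFlag : Flag where
  vertex := (1, 0)
  edge := {(1, 0), (0, 1)}
  face := hexagon (0, 0)
  isEdge := ⟨_, _, by decide, by decide, by decide, rfl⟩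
  isFace := Or.inl ⟨_, by decide, rfl⟩
  vertex_mem := by decide
  edge_subset := by decide

theorem adjFlag_two_triFlag : adjFlag 2 triFlag = hexFlag :=
  (eq_adjFlag ⟨by decide, by decide, by decide⟩).symm

theorem adjFlag_two_hexFlag : adjFlag 2 hexFlag = triFlag :=
  (eq_adjFlag ⟨by decide, by decide, by decide⟩).symm

/-- A symmetry can match the vertex and the edge; the edge lies in only two faces, and `triFlag` and
`hexFlag` supply both. -/
theorem exists_smul (Φ : Flag) : ∃ σ : symGroup, Φ = σ • triFlag ∨ Φ = σ • hexFlag := by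
  have key : ∃ σ : symGroup, σ.1 (1, 0) = Φ.vertex ∧ image σ {(1, 0), (0, 1)} = Φ.edge := by
    obtain ⟨v, w, hv, hw, hvw, he⟩ := Φ.isEdge
    have hmem := Φ.vertex_mem
    rw [he, Finset.mem_insert, Finset.mem_singleton] at hmem
    rcases hmem with h | h
    · obtain ⟨σ, h1, h2⟩ := exists_symm hv hw hvw
      exact ⟨σ, h1.trans h.symm, by simp [image, he, h1, h2]⟩
    · obtain ⟨σ, h1, h2⟩ := exists_symm hw hv (by rwa [sqDist_comm])
      exact ⟨σ, h1.trans h.symm, by simp [image, he, h1, h2, Finset.pair_comm]⟩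
  obtain ⟨σ, hv, he⟩ := key
  refine ⟨σ, ?_⟩
  by_cases hF : Φ.face = (σ • triFlag).face
  · exact Or.inl (Flag.ext hv.symm he.symm hF)
  · right
    rw [← adjFlag_two_triFlag, ← adjFlag_smul]
    exact eq_adjFlag ⟨iff_of_true hv.symm (by decide), iff_of_true he.symm (by decide),
      iff_of_false hF (by decide)⟩

/-! ## Adjacency in terms of symmetries -/

/-- The reflection that fixes the edge of `triFlag` and exchanges its end points. -/
def mirrorEdge : symGroup := reflection (0, 0) (0, 1) (by decide) (by decide)

/-- The reflection that fixes the vertex and the face of `triFlag`. -/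
def mirrorTri : symGroup := reflection (2, 0) (-1, 0) (by decide) (by decide)

/-- The reflection that fixes the vertex and the face of `hexFlag`. -/
def mirrorHex : symGroup := reflection (0, 0) (1, 0) (by decide) (by decide)

theorem adjFlag_zero_triFlag : adjFlag 0 triFlag = mirrorEdge • triFlag :=
  (eq_adjFlag ⟨by decide, by decide, by decide⟩).symm

theorem adjFlag_zero_hexFlag : adjFlag 0 hexFlag = mirrorEdge • hexFlag :=
  (eq_adjFlag ⟨by decide, by decide, by decide⟩).symm

theorem adjFlag_one_triFlag : adjFlag 1 triFlag = mirrorTri • triFlag :=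
  (eq_adjFlag ⟨by decide, by decide, by decide⟩).symm

theorem adjFlag_one_hexFlag : adjFlag 1 hexFlag = mirrorHex • hexFlag :=
  (eq_adjFlag ⟨by decide, by decide, by decide⟩).symm

/-- Translation by `2 * v`. -/
def trans (v : Pt) : symGroup := rotation (2 * v.1, 2 * v.2) (1, 0) (by simp [IsVertex]) (by decide)

/-- The half-turn around `v`. -/
def half (v : Pt) : symGroup := rotation (2 * v.1, 2 * v.2) (-1, 0) (by simp [IsVertex]) (by decide)

theorem trans_apply (v p : Pt) : (trans v).1 p = (p.1 + 2 * v.1, p.2 + 2 * v.2) := by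
  ext <;> simp [trans, rotation, rho] <;> ring

theorem half_apply (v p : Pt) : (half v).1 p = (2 * v.1 - p.1, 2 * v.2 - p.2) := by
  ext <;> simp [half, rotation, rho] <;> ring

theorem symm_mul_apply (σ τ : symGroup) (p : Pt) : (σ * τ).1 p = σ.1 (τ.1 p) := rfl

theorem trans_zero : trans 0 = 1 :=
  symm_ext fun x y => by rw [trans_apply]; simp

theorem trans_mul_trans (u v : Pt) : trans u * trans v = trans (u + v) :=
  symm_ext fun x y => by
    simp only [symm_mul_apply, trans_apply, Prod.fst_add, Prod.snd_add]; ext <;> ring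

theorem trans_mul_half (u v : Pt) : trans u * half v = half (u + v) :=
  symm_ext fun x y => by
    simp only [symm_mul_apply, trans_apply, half_apply, Prod.fst_add, Prod.snd_add]; ext <;> ring

theorem half_mul_trans (u v : Pt) : half u * trans v = half (u - v) :=
  symm_ext fun x y => by
    simp only [symm_mul_apply, trans_apply, half_apply, Prod.fst_sub, Prod.snd_sub]; ext <;> ring

theorem half_mul_half (u v : Pt) : half u * half v = trans (u - v) :=
  symm_ext fun x y => by
    simp only [symm_mul_apply, trans_apply, half_apply, Prod.fst_sub, Prod.snd_sub]; ext <;> ring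

theorem mirrorEdge_apply (p : Pt) : mirrorEdge.1 p = (p.2, p.1) := by
  ext <;> simp [mirrorEdge, reflection, rhoInv]

theorem mirrorTri_apply (p : Pt) : mirrorTri.1 p = (2 - p.1 - p.2, p.2) := by
  ext <;> simp [mirrorTri, reflection, rhoInv] ; ring

theorem mirrorHex_apply (p : Pt) : mirrorHex.1 p = (p.1 + p.2, -p.2) := by
  ext <;> simp [mirrorHex, reflection, rhoInv]

end Trihexagonal

namespace Trihexagonal

/-! ## The monodromy group -/

/-- The action of the monodromy group on the flags. -/
def act (g : tiling.Mon) (Φ : Flag) : Flag := g.1 Φ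

/-- An element of the monodromy group is determined by its values on two orbits of flags. -/
theorem mon_ext {g h : tiling.Mon}
    (htri : ∀ w : symGroup, act g (w • triFlag) = act h (w • triFlag))
    (hhex : ∀ w : symGroup, act g (w • hexFlag) = act h (w • hexFlag)) : g = h := by
  refine Subtype.ext (Equiv.ext fun Φ => ?_)
  obtain ⟨w, rfl | rfl⟩ := exists_smul Φ
  · exact htri w
  · exact hhex w

theorem mon_mul_apply (g h : tiling.Mon) (Φ : Flag) : act (g * h) Φ = act g (act h Φ) := rfl

theorem mon_one_apply (Φ : Flag) : act (1 : tiling.Mon) Φ = Φ := rfl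

theorem monGen_zero_tri (w : symGroup) :
    act (tiling.monGen 0) (w • triFlag) = (w * mirrorEdge) • triFlag := by
  rw [mul_smul_flag, ← adjFlag_zero_triFlag]; exact adjFlag_smul 0 w triFlag

theorem monGen_zero_hex (w : symGroup) :
    act (tiling.monGen 0) (w • hexFlag) = (w * mirrorEdge) • hexFlag := by
  rw [mul_smul_flag, ← adjFlag_zero_hexFlag]; exact adjFlag_smul 0 w hexFlag

theorem monGen_one_tri (w : symGroup) :
    act (tiling.monGen 1) (w • triFlag) = (w * mirrorTri) • triFlag := by
  rw [mul_smul_flag, ← adjFlag_one_triFlag]; exact adjFlag_smul 1 w triFlag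

theorem monGen_one_hex (w : symGroup) :
    act (tiling.monGen 1) (w • hexFlag) = (w * mirrorHex) • hexFlag := by
  rw [mul_smul_flag, ← adjFlag_one_hexFlag]; exact adjFlag_smul 1 w hexFlag

theorem monGen_two_tri (w : symGroup) : act (tiling.monGen 2) (w • triFlag) = w • hexFlag := by
  rw [← adjFlag_two_triFlag]; exact adjFlag_smul 2 w triFlag

theorem monGen_two_hex (w : symGroup) : act (tiling.monGen 2) (w • hexFlag) = w • triFlag := by
  rw [← adjFlag_two_hexFlag]; exact adjFlag_smul 2 w hexFlag

/-- `g` exchanges the two orbits of flags, and is given there by right multiplication with `x`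
and `y`. -/
def Swaps (g : tiling.Mon) (x y : symGroup) : Prop :=
  ∀ w : symGroup, act g (w • triFlag) = (w * x) • hexFlag ∧ act g (w • hexFlag) = (w * y) • triFlag

/-- On both orbits r₀ is the same reflection, so translations stay translations and half-turns stay
half-turns. -/
theorem Swaps.conj_zero {g : tiling.Mon} {x y : symGroup} (h : Swaps g x y) :
    Swaps (tiling.monGen 0 * g * tiling.monGen 0) (mirrorEdge * x * mirrorEdge)
      (mirrorEdge * y * mirrorEdge) := fun w => by
  simp only [mon_mul_apply, monGen_zero_tri, monGen_zero_hex, (h _).1, (h _).2, mul_assoc, and_self]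

/-- The linear parts of `mirrorTri` and `mirrorHex` differ by the factor -1, so this conjugation
interchanges translations and half-turns. -/
theorem Swaps.conj_one {g : tiling.Mon} {x y : symGroup} (h : Swaps g x y) :
    Swaps (tiling.monGen 1 * g * tiling.monGen 1) (mirrorTri * x * mirrorHex)
      (mirrorHex * y * mirrorTri) := fun w => by
  simp only [mon_mul_apply, monGen_one_tri, monGen_one_hex, (h _).1, (h _).2, mul_assoc, and_self]

theorem Swaps.congr {g : tiling.Mon} {x y x' y' : symGroup} (h : Swaps g x y) (hx : x = x')
    (hy : y = y') : Swaps g x' y' := hx ▸ hy ▸ h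

theorem Swaps.unique {g h : tiling.Mon} {x y : symGroup} (hg : Swaps g x y) (hh : Swaps h x y) :
    g = h :=
  mon_ext (fun w => (hg w).1.trans (hh w).1.symm) fun w => (hg w).2.trans (hh w).2.symm

/-- The conjugates of `r₂` by the group `⟨r₀, r₁⟩` that act by translations. -/
noncomputable def transGen : Fin 3 → tiling.Mon :=
  let r := tiling.monGen
  ![r 2, r 1 * (r 0 * (r 1 * r 2 * r 1) * r 0) * r 1,
    r 0 * (r 1 * (r 0 * (r 1 * r 2 * r 1) * r 0) * r 1) * r 0]

/-- The conjugates of `r₂` by the group `⟨r₀, r₁⟩` that act by half-turns. -/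
noncomputable def halfGen : Fin 3 → tiling.Mon :=
  let r := tiling.monGen
  ![r 1 * (r 0 * (r 1 * (r 0 * (r 1 * r 2 * r 1) * r 0) * r 1) * r 0) * r 1,
    r 0 * (r 1 * r 2 * r 1) * r 0, r 1 * r 2 * r 1]

/-- The half-integral vectors that belong to the generators. -/
def genVec : Fin 3 → Pt := ![0, (0, 1), (1, 0)]

/-! ### The action of the six conjugates of r₂ -/

theorem swaps_transGen_zero : Swaps (transGen 0) (trans 0) (trans (-0)) := by
  intro w
  rw [neg_zero, trans_zero, mul_one]
  exact ⟨monGen_two_tri w, monGen_two_hex w⟩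

theorem swaps_halfGen_two : Swaps (halfGen 2) (half (1, 0)) (half (1, 0)) := by
  refine swaps_transGen_zero.conj_one.congr (symm_ext fun x y => ?_) (symm_ext fun x y => ?_) <;>
    simp only [half_apply, neg_zero, trans_zero, mul_one, symm_mul_apply, mirrorTri_apply,
      mirrorHex_apply] <;>
    ext <;> ring

theorem swaps_halfGen_one : Swaps (halfGen 1) (half (0, 1)) (half (0, 1)) := by
  refine swaps_halfGen_two.conj_zero.congr (symm_ext fun x y => ?_) (symm_ext fun x y => ?_) <;>
    simp only [half_apply, symm_mul_apply, mirrorEdge_apply]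

theorem swaps_transGen_one : Swaps (transGen 1) (trans (0, 1)) (trans (-(0, 1))) := by
  refine swaps_halfGen_one.conj_one.congr (symm_ext fun x y => ?_) (symm_ext fun x y => ?_) <;>
    simp only [trans_apply, half_apply, symm_mul_apply, mirrorTri_apply, mirrorHex_apply,
      Prod.neg_mk] <;>
    ext <;> ring

theorem swaps_transGen_two : Swaps (transGen 2) (trans (1, 0)) (trans (-(1, 0))) := by
  refine swaps_transGen_one.conj_zero.congr (symm_ext fun x y => ?_) (symm_ext fun x y => ?_) <;>
    simp only [trans_apply, symm_mul_apply, mirrorEdge_apply, Prod.neg_mk]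

theorem swaps_halfGen_zero : Swaps (halfGen 0) (half 0) (half 0) := by
  refine swaps_transGen_two.conj_one.congr (symm_ext fun x y => ?_) (symm_ext fun x y => ?_) <;>
    simp only [trans_apply, half_apply, symm_mul_apply, mirrorTri_apply, mirrorHex_apply,
      Prod.neg_mk, Prod.fst_zero, Prod.snd_zero] <;>
    ext <;> ring

theorem swaps_transGen (i : Fin 3) :
    Swaps (transGen i) (trans (genVec i)) (trans (-genVec i)) := by
  fin_cases i
  · exact swaps_transGen_zero
  · exact swaps_transGen_one
  · exact swaps_transGen_two

theorem swaps_halfGen (i : Fin 3) : Swaps (halfGen i) (half (genVec i)) (half (genVec i)) := by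
  fin_cases i
  · exact swaps_halfGen_zero
  · exact swaps_halfGen_one
  · exact swaps_halfGen_two

theorem trans_tri (i : Fin 3) (w : symGroup) :
    act (transGen i) (w • triFlag) = (w * trans (genVec i)) • hexFlag := (swaps_transGen i w).1

theorem trans_hex (i : Fin 3) (w : symGroup) :
    act (transGen i) (w • hexFlag) = (w * trans (-genVec i)) • triFlag := (swaps_transGen i w).2

theorem half_tri (i : Fin 3) (w : symGroup) :
    act (halfGen i) (w • triFlag) = (w * half (genVec i)) • hexFlag := (swaps_halfGen i w).1

theorem half_hex (i : Fin 3) (w : symGroup) :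
    act (halfGen i) (w • hexFlag) = (w * half (genVec i)) • triFlag := (swaps_halfGen i w).2

/-! ### Relations between the six conjugates -/

theorem transGen_mul_self (i : Fin 3) : transGen i * transGen i = 1 := by
  refine mon_ext (fun w => ?_) fun w => ?_ <;>
    simp only [mon_mul_apply, mon_one_apply, trans_tri, trans_hex, mul_assoc, trans_mul_trans,
      add_neg_cancel, neg_add_cancel, trans_zero, mul_one]

theorem halfGen_mul_self (i : Fin 3) : halfGen i * halfGen i = 1 := by
  refine mon_ext (fun w => ?_) fun w => ?_ <;>
    simp only [mon_mul_apply, mon_one_apply, half_tri, half_hex, mul_assoc, half_mul_half,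
      sub_self, trans_zero, mul_one]

/-- Right multipliers accumulate in the order in which the factors act, starting with `h`, and the
six factors use the two orbits alternately. -/
theorem Swaps.prod_sq {f g h : tiling.Mon} {x y x' y' x'' y'' : symGroup} (hf : Swaps f x y)
    (hg : Swaps g x' y') (hh : Swaps h x'' y'')
    (h1 : x'' * (y' * (x * (y'' * (x' * y)))) = 1) (h2 : y'' * (x' * (y * (x'' * (y' * x)))) = 1) :
    (f * g * h) ^ 2 = 1 := by
  rw [pow_two]
  refine mon_ext (fun w => ?_) fun w => ?_
  · simp only [mon_mul_apply, mon_one_apply, (hf _).1, (hf _).2, (hg _).1, (hg _).2, (hh _).1,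
      (hh _).2, mul_assoc, h1, mul_one]
  · simp only [mon_mul_apply, mon_one_apply, (hf _).1, (hf _).2, (hg _).1, (hg _).2, (hh _).1,
      (hh _).2, mul_assoc, h2, mul_one]

theorem trans_eq_one {v : Pt} (hv : v = 0) : trans v = 1 := hv ▸ trans_zero

theorem transGen_prod_sq : (transGen 0 * transGen 1 * transGen 2) ^ 2 = 1 := by
  refine swaps_transGen_zero.prod_sq swaps_transGen_one swaps_transGen_two ?_ ?_ <;>
    simp only [trans_mul_trans] <;> exact trans_eq_one (by decide)

theorem halfGen_prod_sq : (halfGen 0 * halfGen 1 * halfGen 2) ^ 2 = 1 := by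
  refine swaps_halfGen_zero.prod_sq swaps_halfGen_one swaps_halfGen_two ?_ ?_ <;>
    simp only [half_mul_half, half_mul_trans] <;> exact trans_eq_one (by decide)

/-- With u and v the vectors of the two generators, both orders give the half-turn around u + v on
triangular flags and around v - u on hexagonal ones. -/
theorem transGen_commute (i j : Fin 3) : Commute (transGen i) (halfGen j) := by
  refine mon_ext (fun w => ?_) fun w => ?_ <;>
    simp only [mon_mul_apply, trans_tri, trans_hex, half_tri, half_hex, mul_assoc,
      trans_mul_half, half_mul_trans] <;> congr 3 <;> abel

/-! ### The homomorphism from H × H to the monodromy group -/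

theorem lift_relatorsH {G : Type*} [Group G] {f : Fin 3 → G} (hf : ∀ i, f i * f i = 1)
    (h : (f 0 * f 1 * f 2) ^ 2 = 1) : ∀ r ∈ relatorsH, FreeGroup.lift f r = 1 := by
  simp only [relatorsH, Set.mem_insert_iff, Set.mem_singleton_iff]
  rintro r (rfl | rfl | rfl | rfl) <;>
    simp only [map_pow, map_mul, FreeGroup.lift_apply_of, h] <;> rw [pow_two, hf]

/-- The homomorphism from `H` to the monodromy group given by `transGen`. -/
noncomputable def transHom : GroupH →* tiling.Mon :=
  PresentedGroup.toGroup (lift_relatorsH transGen_mul_self transGen_prod_sq)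

/-- The homomorphism from `H` to the monodromy group given by `halfGen`. -/
noncomputable def halfHom : GroupH →* tiling.Mon :=
  PresentedGroup.toGroup (lift_relatorsH halfGen_mul_self halfGen_prod_sq)

theorem transHom_genH (i : Fin 3) : transHom (genH i) = transGen i := PresentedGroup.toGroup.of _

theorem halfHom_genH (i : Fin 3) : halfHom (genH i) = halfGen i := PresentedGroup.toGroup.of _

theorem closure_range_genH : Subgroup.closure (Set.range genH) = ⊤ :=
  PresentedGroup.closure_range_of relatorsH

theorem genH_mul_self (i : Fin 3) : genH i * genH i = 1 := by
  have h : ∀ j, FreeGroup.of j ^ 2 ∈ relatorsH := by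
    intro j
    fin_cases j <;> simp [relatorsH]
  rw [← pow_two]
  exact PresentedGroup.one_of_mem (h i)

theorem genH_prod_sq : (genH 0 * genH 1 * genH 2) ^ 2 = 1 :=
  PresentedGroup.one_of_mem (rels := relatorsH)
    (x := (FreeGroup.of 0 * FreeGroup.of 1 * FreeGroup.of 2) ^ 2) (by simp [relatorsH])

theorem genH_inv (i : Fin 3) : (genH i)⁻¹ = genH i := inv_eq_of_mul_eq_one_left (genH_mul_self i)

@[elab_as_elim]
theorem genH_induction {p : GroupH → Prop} (one : p 1) (mul : ∀ h i, p h → p (h * genH i))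
    (h : GroupH) : p h := by
  have hh : h ∈ Subgroup.closure (Set.range genH) := closure_range_genH ▸ Subgroup.mem_top h
  induction hh using Subgroup.closure_induction_right with
  | one => exact one
  | mul_right x _ y hy ih => obtain ⟨i, rfl⟩ := hy; exact mul x i ih
  | mul_inv_cancel x _ y hy ih => obtain ⟨i, rfl⟩ := hy; rw [genH_inv]; exact mul x i ih

theorem transHom_commute (g h : GroupH) : Commute (transHom g) (halfHom h) := by
  induction g using genH_induction with
  | one => simp
  | mul g i ih =>
    rw [map_mul, transHom_genH]
    refine ih.mul_left ?_
    clear ih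
    induction h using genH_induction with
    | one => simp
    | mul h j ih =>
      rw [map_mul, halfHom_genH]
      exact ih.mul_right (transGen_commute i j)

/-- The homomorphism from `H × H` to the monodromy group. -/
noncomputable def prodHom : GroupH × GroupH →* tiling.Mon := transHom.noncommCoprod halfHom transHom_commute

/-! ## Normal forms in `H` -/

end Trihexagonal

namespace Trihexagonal

/-- The element of `H` that corresponds to the translation by `-2 * v`. -/
def latticeH (v : Pt) : GroupH := (genH 1 * genH 0) ^ v.2 * (genH 2 * genH 0) ^ v.1

/-- Since the generators are involutions, (abc)² = 1 means abc = cba. Conjugating by a gives bca =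
acb, then conjugating by b gives bac = cab, hence (ba)(ca) = (ca)(ba). -/
theorem lattice_commute : Commute (genH 1 * genH 0) (genH 2 * genH 0) := by
  have h0 := genH_inv 0
  have h1 := genH_inv 1
  have h2 := genH_inv 2
  have h : genH 0 * genH 1 * genH 2 = genH 2 * genH 1 * genH 0 := by
    have h := eq_inv_of_mul_eq_one_left ((pow_two _).symm.trans genH_prod_sq)
    simpa only [mul_inv_rev, h0, h1, h2, mul_assoc] using h
  have h' : genH 1 * genH 0 * genH 2 = genH 2 * genH 0 * genH 1 := by
    have e : genH 1 * genH 2 * genH 0 = genH 0 * genH 2 * genH 1 := by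
      calc _ = genH 0 * (genH 0 * genH 1 * genH 2) * genH 0 := by
            simp only [← mul_assoc, genH_mul_self, one_mul]
        _ = _ := by
            rw [h]; simp only [mul_assoc, genH_mul_self, mul_one]
    calc genH 1 * genH 0 * genH 2 = genH 1 * (genH 0 * genH 2 * genH 1) * genH 1 := by
          simp only [mul_assoc, genH_mul_self, mul_one]
      _ = _ := by rw [← e]; simp only [← mul_assoc, genH_mul_self, one_mul]
  calc genH 1 * genH 0 * (genH 2 * genH 0) = genH 1 * genH 0 * genH 2 * genH 0 := by
        simp only [mul_assoc]
    _ = _ := by rw [h']; simp only [mul_assoc]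

theorem latticeH_zero : latticeH 0 = 1 := by simp [latticeH]

theorem latticeH_add (u v : Pt) : latticeH (u + v) = latticeH u * latticeH v := by
  simp only [latticeH, Prod.fst_add, Prod.snd_add, zpow_add]
  rw [mul_assoc, mul_assoc, ← mul_assoc (_ ^ v.2), (lattice_commute.zpow_zpow v.2 u.1).eq]
  simp only [mul_assoc]

theorem latticeH_genVec (i : Fin 3) : latticeH (genVec i) = genH i * genH 0 := by
  fin_cases i <;> simp [latticeH, genVec, genH_mul_self]

theorem latticeH_mul_genH (v : Pt) (i : Fin 3) :
    latticeH v * genH i = latticeH (v + genVec i) * genH 0 := by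
  rw [latticeH_add, latticeH_genVec, mul_assoc, mul_assoc, genH_mul_self, mul_one]

theorem latticeH_mul_genH_zero_mul_genH (v : Pt) (i : Fin 3) :
    latticeH v * genH 0 * genH i = latticeH (v - genVec i) := by
  have h := latticeH_add (v - genVec i) (genVec i)
  rw [sub_add_cancel, latticeH_genVec] at h
  rw [h]
  simp only [mul_assoc, genH_mul_self, mul_one]

/-- Reading a word letter by letter gives a normal form and the action together. Nothing is claimed
about uniqueness of the normal form: that v is determined will follow from the action. Even elements
translate the two orbits in opposite directions. -/
theorem transHom_act (h : GroupH) : ∃ v : Pt,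
    (h = latticeH v ∧ ∀ w : symGroup,
      act (transHom h) (w • triFlag) = (w * trans (-v)) • triFlag ∧
      act (transHom h) (w • hexFlag) = (w * trans v) • hexFlag) ∨
    (h = latticeH v * genH 0 ∧ ∀ w : symGroup,
      act (transHom h) (w • triFlag) = (w * trans v) • hexFlag ∧
      act (transHom h) (w • hexFlag) = (w * trans (-v)) • triFlag) := by
  induction h using genH_induction with
  | one =>
    refine ⟨0, Or.inl ⟨latticeH_zero.symm, fun w => ?_⟩⟩
    rw [map_one, neg_zero, trans_zero, mul_one]
    exact ⟨rfl, rfl⟩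
  | mul h i ih =>
    rw [map_mul, transHom_genH]
    obtain ⟨v, ⟨rfl, hv⟩ | ⟨rfl, hv⟩⟩ := ih
    · refine ⟨v + genVec i, Or.inr ⟨latticeH_mul_genH v i, fun w => ?_⟩⟩
      simp only [mon_mul_apply, trans_tri, trans_hex, (hv _).1, (hv _).2, mul_assoc,
        trans_mul_trans]
      exact ⟨by rw [add_comm], by rw [neg_add_rev]⟩
    · refine ⟨v - genVec i, Or.inl ⟨latticeH_mul_genH_zero_mul_genH v i, fun w => ?_⟩⟩
      simp only [mon_mul_apply, trans_tri, trans_hex, (hv _).1, (hv _).2, mul_assoc,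
        trans_mul_trans]
      exact ⟨by rw [neg_sub, sub_eq_add_neg], by rw [sub_eq_add_neg, add_comm]⟩

/-- In contrast to `transHom_act`, even elements translate both orbits in the same direction, which
makes the two factors independent. -/
theorem halfHom_act (h : GroupH) : ∃ v : Pt,
    (h = latticeH v ∧ ∀ w : symGroup,
      act (halfHom h) (w • triFlag) = (w * trans (-v)) • triFlag ∧
      act (halfHom h) (w • hexFlag) = (w * trans (-v)) • hexFlag) ∨
    (h = latticeH v * genH 0 ∧ ∀ w : symGroup,
      act (halfHom h) (w • triFlag) = (w * half v) • hexFlag ∧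
      act (halfHom h) (w • hexFlag) = (w * half v) • triFlag) := by
  induction h using genH_induction with
  | one =>
    refine ⟨0, Or.inl ⟨latticeH_zero.symm, fun w => ?_⟩⟩
    rw [map_one, neg_zero, trans_zero, mul_one]
    exact ⟨rfl, rfl⟩
  | mul h i ih =>
    rw [map_mul, halfHom_genH]
    obtain ⟨v, ⟨rfl, hv⟩ | ⟨rfl, hv⟩⟩ := ih
    · refine ⟨v + genVec i, Or.inr ⟨latticeH_mul_genH v i, fun w => ?_⟩⟩
      simp only [mon_mul_apply, half_tri, half_hex, (hv _).1, (hv _).2, mul_assoc,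
        half_mul_trans, sub_neg_eq_add, add_comm v, and_self]
    · refine ⟨v - genVec i, Or.inl ⟨latticeH_mul_genH_zero_mul_genH v i, fun w => ?_⟩⟩
      simp only [mon_mul_apply, half_tri, half_hex, (hv _).1, (hv _).2, mul_assoc,
        half_mul_half, neg_sub, and_self]

/-! ## Faces of the minimal regular cover -/

theorem act_monGen_face {i : Fin 3} (hi : i ≠ 2) (Φ : Flag) :
    (act (tiling.monGen i) Φ).face = Φ.face := (isAdj_adjFlag i Φ).2.2.2 hi

/-- The sum of the three corners moves by 6v. -/
theorem image_trans_tri {v : Pt} (h : (trans v • triFlag).face = triFlag.face) : v = 0 := by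
  have hs := congrArg (fun F => ∑ p ∈ F, p) h
  simp only [smul_face, image, Finset.sum_map, Equiv.toEmbedding_apply, trans_apply] at hs
  simp [triFlag] at hs
  ext <;> simp <;> omega

theorem image_trans_hex {v : Pt} (h : (trans v • hexFlag).face = hexFlag.face) : v = 0 := by
  have hs := congrArg (fun F => ∑ p ∈ F, p) h
  simp only [smul_face, image, Finset.sum_map, Equiv.toEmbedding_apply, trans_apply] at hs
  simp [hexFlag, hexagon] at hs
  ext <;> simp <;> omega

/-- The corners of the base triangle sum to (2, 2), those of its image to 6v - (2, 2), and 6 does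
not divide 4. -/
theorem image_half_tri {v : Pt} (h : (half v • triFlag).face = triFlag.face) : False := by
  have hs := congrArg (fun F => ∑ p ∈ F, p) h
  simp only [smul_face, image, Finset.sum_map, Equiv.toEmbedding_apply, half_apply] at hs
  simp [triFlag] at hs
  omega

theorem smul_hex_ne_tri {w : symGroup} (h : (w • hexFlag).face = triFlag.face) : False := by
  have hs := congrArg Finset.card h
  rw [smul_face, image, Finset.card_map] at hs
  revert hs
  decide

theorem prodHom_apply (g h : GroupH) : prodHom (g, h) = transHom g * halfHom h := rfl

/-- If just one component is odd, triangles go to hexagons; if both are odd, the base triangle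
undergoes a half-turn. If both are even, with vectors u and v, the two base faces are translated
along -(u + v) and u - v, so both vectors vanish. -/
theorem eq_one_of_face_eq {g : GroupH × GroupH}
    (hg : ∀ Φ, (act (prodHom g) Φ).face = Φ.face) : g = 1 := by
  obtain ⟨g, h⟩ := g
  have ht := hg ((1 : symGroup) • triFlag)
  have hh := hg ((1 : symGroup) • hexFlag)
  rw [prodHom_apply, mon_mul_apply] at ht hh
  obtain ⟨u, ⟨rfl, hu⟩ | ⟨rfl, hu⟩⟩ := transHom_act g <;>
    obtain ⟨v, ⟨rfl, hv⟩ | ⟨rfl, hv⟩⟩ := halfHom_act h <;>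
    simp only [(hu _).1, (hu _).2, (hv _).1, (hv _).2, one_mul, trans_mul_trans,
      half_mul_trans] at ht hh <;>
    rw [one_smul_flag triFlag] at ht <;>
    rw [one_smul_flag hexFlag] at hh
  · have h1 := image_trans_tri ht
    have h2 := image_trans_hex hh
    have hu : u = 0 := by
      simp only [Prod.ext_iff, Prod.fst_add, Prod.snd_add, Prod.fst_neg, Prod.snd_neg,
        Prod.fst_zero, Prod.snd_zero] at h1 h2 ⊢
      omega
    have hv : v = 0 := by
      simpa [hu] using h1
    rw [hu, hv, latticeH_zero, Prod.mk_one_one]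
  · exact (smul_hex_ne_tri ht).elim
  · exact (smul_hex_ne_tri ht).elim
  · exact (image_half_tri ht).elim

end Trihexagonal

/-! ### Cells and dual graphs of arbitrary maps -/

namespace FlagMap

theorem cell_adj (M : FlagMap) {i j : Fin 3} (h : j ≠ i) (Φ : M.Flag) :
    M.cell i (M.adj j Φ) = M.cell i Φ :=
  Quotient.sound (MulAction.orbitRel_apply.2
    ⟨⟨M.adj j, Subgroup.subset_closure ⟨j, h, rfl⟩⟩, rfl⟩)

theorem cell_induction (M : FlagMap) {i : Fin 3} {p : M.Flag → Prop} {Φ Ψ : M.Flag}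
    (h : M.cell i Ψ = M.cell i Φ) (hΦ : p Φ) (step : ∀ Ψ, ∀ j ≠ i, p Ψ → p (M.adj j Ψ)) : p Ψ := by
  obtain ⟨⟨g, hg⟩, rfl⟩ := MulAction.orbitRel_apply.1 (Quotient.exact h)
  change p (g Φ)
  clear h
  have hinv : ∀ j, (M.adj j)⁻¹ = M.adj j := fun j =>
    inv_eq_of_mul_eq_one_left (Equiv.ext fun Φ => M.adj_adj j Φ)
  induction hg using Subgroup.closure_induction_left with
  | one => exact hΦ
  | mul_left x hx y _ ih => obtain ⟨j, hj, rfl⟩ := hx; exact step _ j hj ih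
  | inv_mul_cancel x hx y _ ih =>
    obtain ⟨j, hj, rfl⟩ := hx
    rw [hinv]
    exact step _ j hj ih

/-- Since r₀ and r₂ commute, moving along an edge preserves the unordered pair formed by the faces
of a flag and of its 2-adjacent flag. So an edge lies in no other faces. -/
theorem dualGraph_adj_iff (M : FlagMap) {F F' : M.Cell 2} :
    M.dualGraph.Adj F F' ↔
      F ≠ F' ∧ ∃ Φ, M.cell 2 Φ = F ∧ M.cell 2 (M.adj 2 Φ) = F' := by
  refine and_congr_right fun hne => ⟨?_, ?_⟩
  · rintro ⟨e, ⟨Φ, hΦ, rfl⟩, ⟨Ψ, hΨ, rfl⟩⟩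
    have key : (M.cell 2 Ψ = M.cell 2 Φ ∧ M.cell 2 (M.adj 2 Ψ) = M.cell 2 (M.adj 2 Φ)) ∨
        (M.cell 2 Ψ = M.cell 2 (M.adj 2 Φ) ∧ M.cell 2 (M.adj 2 Ψ) = M.cell 2 Φ) := by
      refine M.cell_induction (hΨ.trans hΦ.symm)
        (p := fun Ψ => (M.cell 2 Ψ = M.cell 2 Φ ∧
          M.cell 2 (M.adj 2 Ψ) = M.cell 2 (M.adj 2 Φ)) ∨
          (M.cell 2 Ψ = M.cell 2 (M.adj 2 Φ) ∧ M.cell 2 (M.adj 2 Ψ) = M.cell 2 Φ))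
        (Or.inl ⟨rfl, rfl⟩) fun Ω j hj h => ?_
      match j with
      | 0 => rwa [← M.adj_comm, M.cell_adj (by decide), M.cell_adj (by decide)]
      | 1 => exact absurd rfl hj
      | 2 =>
        rw [M.adj_adj]
        exact h.symm.imp And.symm And.symm
    rcases key with h | h
    · exact absurd h.1.symm hne
    · exact ⟨Φ, rfl, h.1.symm⟩
  · rintro ⟨Φ, rfl, rfl⟩
    exact ⟨M.cell 1 Φ, ⟨Φ, rfl, rfl⟩, ⟨M.adj 2 Φ, M.cell_adj (by decide) Φ, rfl⟩⟩

theorem closure_range_monGen (M : FlagMap) : Subgroup.closure (Set.range M.monGen) = ⊤ := by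
  refine Eq.trans (congrArg _ ?_) (Subgroup.closure_closure_coe_preimage (k := Set.range M.adj))
  ext x
  exact ⟨fun ⟨i, hi⟩ => ⟨i, congrArg Subtype.val hi⟩, fun ⟨i, hi⟩ => ⟨i, Subtype.ext hi⟩⟩

theorem monGen_inv (M : FlagMap) (i : Fin 3) : (M.monGen i)⁻¹ = M.monGen i :=
  inv_eq_of_mul_eq_one_left (M.monGen_mul_self i)

end FlagMap

/-- A graph isomorphism from the Cayley graph of a group with respect to a set of involutions
induces a labelling of the edges. -/
theorem exists_isCayleyLabelling {V G : Type} [Group G] {Λ : SimpleGraph V} {A : Set G}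
    (hfin : A.Finite) (hsq : ∀ a ∈ A, a * a = 1) (hgen : Subgroup.closure A = ⊤)
    (hone : (1 : G) ∉ A) (φ : SimpleGraph.mulCayley A ≃g Λ) :
    ∃ label : Λ.edgeSet → G, IsCayleyLabelling Λ A label := by
  have hinv : ∀ a ∈ A, a⁻¹ = a := fun a ha => inv_eq_of_mul_eq_one_left (hsq a ha)
  -- The label is well defined: read from its other end, the edge joins ga to g = (ga)a and again
  -- gets the label a, because a is an involution.
  refine ⟨fun e => Classical.epsilon fun a => a ∈ A ∧ ∃ g, e.1 = s(φ g, φ (g * a)), hfin,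
    fun a ha => (hinv a ha).symm ▸ ha, hgen, hone, φ, fun g a ha h => ?_⟩
  obtain ⟨hb, g', hg'⟩ := Classical.epsilon_spec
    (p := fun b => b ∈ A ∧ ∃ g', s(φ g, φ (g * a)) = s(φ g', φ (g' * b))) ⟨a, ha, g, rfl⟩
  change Classical.epsilon (fun b => b ∈ A ∧ ∃ g', s(φ g, φ (g * a)) = s(φ g', φ (g' * b))) = a
  generalize Classical.epsilon
    (fun b => b ∈ A ∧ ∃ g', s(φ g, φ (g * a)) = s(φ g', φ (g' * b))) = b at hb hg' ⊢
  rcases Sym2.eq_iff.1 hg' with ⟨h1, h2⟩ | ⟨h1, h2⟩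
  · obtain rfl := φ.injective h1
    exact (mul_left_cancel (φ.injective h2)).symm
  · obtain rfl := φ.injective h2
    have h3 := φ.injective h1
    rw [mul_assoc, left_eq_mul] at h3
    rw [eq_inv_of_mul_eq_one_right h3, hinv a ha]

/-! ### The faces of the cover as elements of H × H -/

namespace Trihexagonal

/-- The face of the minimal regular cover that contains the flag `m`. -/
noncomputable def faceCell (m : tiling.Mon) : tiling.minimalRegularCover.Cell 2 :=
  tiling.minimalRegularCover.cell 2 m

/-- The flags of the base face of the minimal regular cover. -/
noncomputable def baseFace : Subgroup tiling.Mon :=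
  Subgroup.closure {tiling.monGen 0, tiling.monGen 1}

theorem monGen_mem_baseFace {i : Fin 3} (hi : i ≠ 2) : tiling.monGen i ∈ baseFace := by
  refine Subgroup.subset_closure ?_
  fin_cases i
  · exact Or.inl rfl
  · exact Or.inr rfl
  · exact absurd rfl hi

theorem baseFace_induction {p : tiling.Mon → Prop} {d : tiling.Mon} (hd : d ∈ baseFace)
    (one : p 1) (mul : ∀ y, ∀ i ≠ 2, p y → p (tiling.monGen i * y)) : p d := by
  induction hd using Subgroup.closure_induction_left with
  | one => exact one
  | mul_left x hx y _ ih =>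
    obtain rfl | rfl := hx <;> exact mul y _ (by decide) ih
  | inv_mul_cancel x hx y _ ih =>
    obtain rfl | rfl := hx <;> rw [FlagMap.monGen_inv] <;> exact mul y _ (by decide) ih

theorem faceCell_mul (m : tiling.Mon) {d : tiling.Mon} (hd : d ∈ baseFace) :
    faceCell (m * d) = faceCell m := by
  revert m
  refine baseFace_induction (p := fun d => ∀ m, faceCell (m * d) = faceCell m) hd
    (fun m => by rw [mul_one]) fun y i hi ih m => ?_
  rw [← mul_assoc, ih]
  exact tiling.minimalRegularCover.cell_adj hi m

/-- Inversion turns the right factor rⱼ of a flag of the cover into a left factor, which acts last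
and for j ≠ 2 keeps the face. This detects cosets of `baseFace` by faces of the tiling. -/
theorem act_face_of_faceCell_eq {m n : tiling.Mon} (h : faceCell m = faceCell n) (Φ : Flag) :
    (act m⁻¹ Φ).face = (act n⁻¹ Φ).face := by
  have step : ∀ (m : tiling.Mon) (j : Fin 3), j ≠ 2 → (act m⁻¹ Φ).face = (act n⁻¹ Φ).face →
      (act (m * tiling.monGen j)⁻¹ Φ).face = (act n⁻¹ Φ).face := by
    intro m j hj ih
    rw [mul_inv_rev, FlagMap.monGen_inv, mon_mul_apply, act_monGen_face hj, ih]
  exact tiling.minimalRegularCover.cell_induction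
    (p := fun m : tiling.Mon => (act m⁻¹ Φ).face = (act n⁻¹ Φ).face) h rfl step

/-- The conjugates of `r₂` by the group `⟨r₀, r₁⟩`. -/
def conjugates : Set tiling.Mon := Set.range transGen ∪ Set.range halfGen

theorem conj_conj (i : Fin 3) (m : tiling.Mon) :
    tiling.monGen i * (tiling.monGen i * m * tiling.monGen i) * tiling.monGen i = m := by
  simp only [mul_assoc, FlagMap.monGen_mul_self, mul_one]
  rw [← mul_assoc, FlagMap.monGen_mul_self, one_mul]

/-- Conjugation by r₁ and r₀ alternately runs along the path `transGen 0`, `halfGen 2`, `halfGen 1`,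
`transGen 1`, `transGen 2`, `halfGen 0`, whose two ends are fixed by r₀. -/
theorem conj_mem_conjugates {i : Fin 3} (hi : i ≠ 2) {m : tiling.Mon} (hm : m ∈ conjugates) :
    tiling.monGen i * m * tiling.monGen i ∈ conjugates := by
  have ht : ∀ j, transGen j ∈ conjugates := fun j => Or.inl ⟨j, rfl⟩
  have hh : ∀ j, halfGen j ∈ conjugates := fun j => Or.inr ⟨j, rfl⟩
  match i with
  | 0 =>
    obtain ⟨j, rfl⟩ | ⟨j, rfl⟩ := hm <;> fin_cases j
    · change tiling.monGen 0 * tiling.monGen 2 * tiling.monGen 0 ∈ conjugates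
      rw [FlagMap.monGen_comm, mul_assoc, FlagMap.monGen_mul_self, mul_one]
      exact ht 0
    · exact ht 2
    · exact (conj_conj 0 (transGen 1)).symm ▸ ht 1
    -- The only case not settled by the defining words or by r₀r₂ = r₂r₀: the mirror of r₀ passes
    -- through the centre of the half-turn.
    · have h : tiling.monGen 0 * halfGen 0 * tiling.monGen 0 = halfGen 0 := by
        refine (swaps_halfGen_zero.conj_zero.congr (symm_ext fun x y => ?_)
          (symm_ext fun x y => ?_)).unique swaps_halfGen_zero <;>
          simp only [half_apply, symm_mul_apply, mirrorEdge_apply, Prod.fst_zero, Prod.snd_zero]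
      exact h.symm ▸ hh 0
    · exact (conj_conj 0 (halfGen 2)).symm ▸ hh 2
    · exact hh 1
  | 1 =>
    obtain ⟨j, rfl⟩ | ⟨j, rfl⟩ := hm <;> fin_cases j
    · exact hh 2
    · exact (conj_conj 1 (halfGen 1)).symm ▸ hh 1
    · exact hh 0
    · exact (conj_conj 1 (transGen 2)).symm ▸ ht 2
    · exact ht 1
    · exact (conj_conj 1 (transGen 0)).symm ▸ ht 0
  | 2 => exact absurd rfl hi

theorem conj_mem_conjugates_of_mem {d : tiling.Mon} (hd : d ∈ baseFace) :
    d * tiling.monGen 2 * d⁻¹ ∈ conjugates := by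
  refine baseFace_induction (p := fun d => d * tiling.monGen 2 * d⁻¹ ∈ conjugates) hd ?_
    fun y i hi ih => ?_
  · rw [one_mul, inv_one, mul_one]
    exact Or.inl ⟨0, rfl⟩
  · have h := conj_mem_conjugates hi ih
    rw [mul_inv_rev, FlagMap.monGen_inv]
    simpa only [mul_assoc] using h

theorem exists_eq_conj {m : tiling.Mon} (hm : m ∈ conjugates) :
    ∃ d ∈ baseFace, m = d * tiling.monGen 2 * d⁻¹ := by
  have step : ∀ i ≠ 2, ∀ m, (∃ d ∈ baseFace, m = d * tiling.monGen 2 * d⁻¹) →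
      ∃ d ∈ baseFace, tiling.monGen i * m * tiling.monGen i = d * tiling.monGen 2 * d⁻¹ := by
    rintro i hi _ ⟨d, hd, rfl⟩
    refine ⟨tiling.monGen i * d, mul_mem (monGen_mem_baseFace hi) hd, ?_⟩
    rw [mul_inv_rev, FlagMap.monGen_inv]
    simp only [mul_assoc]
  have t0 : ∃ d ∈ baseFace, transGen 0 = d * tiling.monGen 2 * d⁻¹ :=
    ⟨1, one_mem _, by rw [one_mul, inv_one, mul_one]; rfl⟩
  have h2 := step 1 (by decide) _ t0
  have h1 := step 0 (by decide) _ h2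
  have t1 := step 1 (by decide) _ h1
  have t2 := step 0 (by decide) _ t1
  have h0 := step 1 (by decide) _ t2
  obtain ⟨j, rfl⟩ | ⟨j, rfl⟩ := hm <;> fin_cases j
  · exact t0
  · exact t1
  · exact t2
  · exact h0
  · exact h1
  · exact h2

/-- The generators of `H × H`. -/
def genHH : Set (GroupH × GroupH) :=
  {(genH 0, 1), (genH 1, 1), (genH 2, 1), (1, genH 0), (1, genH 1), (1, genH 2)}

theorem mem_genHH {x : GroupH × GroupH} :
    x ∈ genHH ↔ (∃ i, x = (genH i, 1)) ∨ ∃ i, x = (1, genH i) := by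
  simp only [genHH, Set.mem_insert_iff, Set.mem_singleton_iff, Fin.exists_fin_succ,
    IsEmpty.exists_iff, or_false, or_assoc]
  rfl

theorem mul_self_of_mem_genHH {x : GroupH × GroupH} (hx : x ∈ genHH) : x * x = 1 := by
  obtain ⟨i, rfl⟩ | ⟨i, rfl⟩ := mem_genHH.1 hx <;>
    rw [Prod.mk_mul_mk, genH_mul_self, mul_one, Prod.mk_one_one]

/-- Its image under `transHom` takes a triangular flag to a hexagonal one. -/
theorem genH_ne_one (i : Fin 3) : genH i ≠ 1 := by
  intro h
  have h1 := trans_tri i 1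
  rw [← transHom_genH, h, map_one, mon_one_apply, one_smul_flag] at h1
  exact smul_hex_ne_tri (congrArg Flag.face h1).symm

theorem one_notMem_genHH : (1 : GroupH × GroupH) ∉ genHH := by
  intro h
  obtain ⟨i, h⟩ | ⟨i, h⟩ := mem_genHH.1 h
  · exact genH_ne_one i (congrArg Prod.fst h).symm
  · exact genH_ne_one i (congrArg Prod.snd h).symm

theorem closure_genHH : Subgroup.closure genHH = ⊤ := by
  refine (Subgroup.eq_top_iff' _).2 fun ⟨g, h⟩ => ?_
  have hl : (g, (1 : GroupH)) ∈ Subgroup.closure genHH := by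
    induction g using genH_induction with
    | one => exact one_mem _
    | mul g i ih =>
      have := mul_mem ih (Subgroup.subset_closure (mem_genHH.2 (Or.inl ⟨i, rfl⟩)))
      rwa [Prod.mk_mul_mk, mul_one] at this
  have hr : ((1 : GroupH), h) ∈ Subgroup.closure genHH := by
    induction h using genH_induction with
    | one => exact one_mem _
    | mul h i ih =>
      have := mul_mem ih (Subgroup.subset_closure (mem_genHH.2 (Or.inr ⟨i, rfl⟩)))
      rwa [Prod.mk_mul_mk, mul_one] at this
  simpa only [Prod.mk_mul_mk, mul_one, one_mul] using mul_mem hl hr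

theorem prodHom_mem_conjugates {x : GroupH × GroupH} (hx : x ∈ genHH) :
    prodHom x ∈ conjugates := by
  obtain ⟨i, rfl⟩ | ⟨i, rfl⟩ := mem_genHH.1 hx
  · rw [prodHom_apply, map_one, mul_one, transHom_genH]
    exact Or.inl ⟨i, rfl⟩
  · rw [prodHom_apply, map_one, one_mul, halfHom_genH]
    exact Or.inr ⟨i, rfl⟩

theorem exists_prodHom_eq {m : tiling.Mon} (hm : m ∈ conjugates) :
    ∃ x ∈ genHH, prodHom x = m := by
  obtain ⟨i, rfl⟩ | ⟨i, rfl⟩ := hm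
  · refine ⟨(genH i, 1), mem_genHH.2 (Or.inl ⟨i, rfl⟩), ?_⟩
    rw [prodHom_apply, map_one, mul_one, transHom_genH]
  · refine ⟨(1, genH i), mem_genHH.2 (Or.inr ⟨i, rfl⟩), ?_⟩
    rw [prodHom_apply, map_one, one_mul, halfHom_genH]

/-- Write d r₂ = (d r₂ d⁻¹) d: crossing an edge multiplies the H × H part by a generator and leaves
d alone. -/
theorem prodHom_mul_mul_monGen_two (g : GroupH × GroupH) {d : tiling.Mon} (hd : d ∈ baseFace) :
    ∃ x ∈ genHH, prodHom g * d * tiling.monGen 2 = prodHom (g * x) * d := by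
  obtain ⟨x, hx, h⟩ := exists_prodHom_eq (conj_mem_conjugates_of_mem hd)
  refine ⟨x, hx, ?_⟩
  rw [map_mul, h]
  simp only [mul_assoc, inv_mul_cancel, mul_one]

theorem exists_eq_prodHom_mul (m : tiling.Mon) :
    ∃ g, ∃ d ∈ baseFace, m = prodHom g * d := by
  have step : ∀ m i, (∃ g, ∃ d ∈ baseFace, m = prodHom g * d) →
      ∃ g, ∃ d ∈ baseFace, m * tiling.monGen i = prodHom g * d := by
    rintro _ i ⟨g, d, hd, rfl⟩
    by_cases hi : i = 2
    · subst hi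
      obtain ⟨x, -, h⟩ := prodHom_mul_mul_monGen_two g hd
      exact ⟨g * x, d, hd, h⟩
    · exact ⟨g, d * tiling.monGen i, mul_mem hd (monGen_mem_baseFace hi), mul_assoc _ _ _⟩
  have hm : m ∈ Subgroup.closure (Set.range tiling.monGen) :=
    tiling.closure_range_monGen ▸ Subgroup.mem_top m
  induction hm using Subgroup.closure_induction_right with
  | one => exact ⟨1, 1, one_mem _, by rw [map_one, mul_one]⟩
  | mul_right x _ y hy ih => obtain ⟨i, rfl⟩ := hy; exact step x i ih
  | mul_inv_cancel x _ y hy ih =>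
    obtain ⟨i, rfl⟩ := hy
    rw [FlagMap.monGen_inv]
    exact step x i ih

theorem faceCell_prodHom_injective : Function.Injective fun g => faceCell (prodHom g) := by
  intro g h hgh
  refine eq_of_inv_mul_eq_one (eq_one_of_face_eq fun Φ => ?_)
  have := act_face_of_faceCell_eq hgh (act (prodHom h) Φ)
  rw [← mon_mul_apply, ← mon_mul_apply, inv_mul_cancel, mon_one_apply, ← map_inv, ← map_mul] at this
  exact this

/-- The faces of the minimal regular cover correspond to the elements of `H × H`. -/
noncomputable def faceEquiv : GroupH × GroupH ≃ tiling.minimalRegularCover.Cell 2 :=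
  Equiv.ofBijective (fun g => faceCell (prodHom g)) ⟨faceCell_prodHom_injective, fun F => by
    obtain ⟨m, rfl⟩ := Quotient.exists_rep F
    obtain ⟨g, d, hd, h⟩ := exists_eq_prodHom_mul m
    exact ⟨g, (faceCell_mul _ hd).symm.trans (congrArg faceCell h.symm)⟩⟩

theorem dualGraph_adj_faceEquiv {g h : GroupH × GroupH} :
    tiling.minimalRegularCover.dualGraph.Adj (faceEquiv g) (faceEquiv h) ↔
      (SimpleGraph.mulCayley genHH).Adj g h := by
  rw [FlagMap.dualGraph_adj_iff, SimpleGraph.mulCayley_adj, faceEquiv.injective.ne_iff]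
  refine and_congr_right fun _ => ⟨?_, fun hgh => ?_⟩
  · rintro ⟨m, h1, h2⟩
    obtain ⟨k, d, hd, rfl⟩ := exists_eq_prodHom_mul m
    obtain rfl := faceCell_prodHom_injective ((faceCell_mul _ hd).symm.trans h1)
    obtain ⟨x, hx, hk⟩ := prodHom_mul_mul_monGen_two k hd
    have h3 : faceCell (prodHom (k * x)) = faceCell (prodHom h) :=
      ((faceCell_mul _ hd).symm.trans (congrArg faceCell hk.symm)).trans h2
    obtain rfl := faceCell_prodHom_injective h3
    left
    rwa [inv_mul_cancel_left]
  · have hx : g⁻¹ * h ∈ genHH := by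
      rcases hgh with hx | hx
      · exact hx
      -- The generators are involutions, so the two directions of a Cayley edge give the same
      -- condition.
      · rwa [← inv_eq_of_mul_eq_one_left (mul_self_of_mem_genHH hx), mul_inv_rev, inv_inv] at hx
    obtain ⟨d, hd, hxd⟩ := exists_eq_conj (prodHom_mem_conjugates hx)
    refine ⟨(prodHom g * d : tiling.Mon), faceCell_mul _ hd, ?_⟩
    have e : prodHom g * d * tiling.monGen 2 = prodHom h * d := by
      rw [← mul_inv_cancel_left g h, map_mul prodHom g, hxd]
      simp only [mul_assoc, inv_mul_cancel, mul_one]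
    exact (congrArg faceCell e).trans (faceCell_mul _ hd)

end Trihexagonal

theorem mainTheorem8 :
    ∃ (G : Type) (_ : Group G) (e : G ≃* GroupH × GroupH) (A : Set G)
      (label : Trihexagonal.tiling.minimalRegularCover.dualGraph.edgeSet → G),
      e '' A = {(genH 0, 1), (genH 1, 1), (genH 2, 1), (1, genH 0), (1, genH 1), (1, genH 2)} ∧
      IsCayleyLabelling Trihexagonal.tiling.minimalRegularCover.dualGraph A label := by
  obtain ⟨label, h⟩ := exists_isCayleyLabelling (A := Trihexagonal.genHH)
    (Set.toFinite {(genH 0, 1), (genH 1, 1), (genH 2, 1), (1, genH 0), (1, genH 1), (1, genH 2)})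
    (fun _ => Trihexagonal.mul_self_of_mem_genHH) Trihexagonal.closure_genHH
    Trihexagonal.one_notMem_genHH
    ⟨Trihexagonal.faceEquiv, Trihexagonal.dualGraph_adj_faceEquiv⟩
  exact ⟨GroupH × GroupH, inferInstance, MulEquiv.refl _, Trihexagonal.genHH, label,
    Set.image_id _, h⟩
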